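/- Let $\mathbb D=\{z\in\mathbb C:|z|<1\}$ and $\Lambda=\mathbb C\setminus[1,+\infty)$. Let $\mathcal T$ be the set of functions $F$ holomorphic on $\Lambda$ such that $F(z)=\sum_{n\ge0}a_nz^n$ for $z\in\mathbb D$, where $a_0=1$ and $a_n=\int_0^1t^n\,d\mu(t)$ $(n\ge 0)$ for some positive Borel measure $\mu$ on $[0,1]$; let $\widetilde{\mathcal T}=\{zF(z):F\in\mathcal T\}$. For a constant $c$ with $|c|<1$ let $\mathcal{HT}(c)$ be the set of harmonic functions on $\Lambda$ of the form $h+c\,\overline g$ with $h,g\in\widetilde{\mathcal T}$. For $h,g$ holomorphic on $\mathbb D$ with $h(z)=\sum_{n\ge 0} h_nz^n$ and $g(z)=\sum_{n\ge 0} g_nz^n$, let $(h\ast g)(z)=\sum_{n\ge 0} h_ng_nz^n$. For $k<1$, a harmonic mapping $f:\mathbb D\to\mathbb C$ is called $k$-quasiconformal on $\mathbb D$ if it is injective and sense-preserving, i.e. $|f_z|^2-|f_{\bar z}|^2>0$ on $\mathbb D$, and $\left|\overline{f_{\bar z}}/f_z\right|\le k$ on $\mathbb D$. **Theorem.** Let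 $h\in\widetilde{\mathcal T}$, let $0\le c<1$ be real, and suppose that $M$ is a real number with $$\left|\frac{h'(tz)}{h'(z)}\right|\le M,\qquad z\in\mathbb D,\ 0\le t\le1 .$$ Then for every $g\in\widetilde{\mathcal T}$ the harmonic mapping $$f(z)=h(z)+c\,\overline{(h\ast g)(z)},\qquad z\in\mathbb D,$$ belongs to $\mathcal{HT}(c)$, in the sense that it is the restriction to $\mathbb D$ of a function in $\mathcal{HT}(c)$, and $f$ is $k$-quasiconformal on $\mathbb D$ for every real $k$ with $cM\le k<1$. -/

import Mathlib

open MeasureTheory Metric Set Topology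
open scoped ComplexConjugate

noncomputable section

namespace HarmonicHausdorff

/-- The open unit disk. -/
def unitDisk : Set ℂ := ball 0 1

/-- The slit domain `ℂ \ [1, +∞)`. -/
def slitDomain : Set ℂ := {z : ℂ | ∀ x : ℝ, 1 ≤ x → z ≠ (x : ℂ)}

/-- `a` is a Hausdorff moment sequence: `a n = ∫ tⁿ dμ(t)` for a finite positive Borel measure
`μ` on `[0, 1]`. -/
def IsHausdorffMomentSeq (a : ℕ → ℝ) : Prop :=
  ∃ μ : Measure unitInterval, IsFiniteMeasure μ ∧ ∀ n : ℕ, a n = ∫ t, (t : ℝ) ^ n ∂μ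

/-- The class `𝒯`: holomorphic functions on the slit domain that on the unit disk are the
generating function of a normalized Hausdorff moment sequence. Functions are total; only their
values on the slit domain matter. -/
def classT : Set (ℂ → ℂ) :=
  {F | DifferentiableOn ℂ F slitDomain ∧
    ∃ a : ℕ → ℝ, IsHausdorffMomentSeq a ∧ a 0 = 1 ∧
      ∀ z ∈ unitDisk, HasSum (fun n : ℕ => (a n : ℂ) * z ^ n) (F z)}

/-- The class of shifted generating functions `z F(z)`, `F ∈ 𝒯`. -/
def shiftedT : Set (ℂ → ℂ) :=
  {h | ∃ F ∈ classT, ∀ z ∈ slitDomain, h z = z * F z}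

/-- The class `ℋ𝒯(c)` of harmonic functions `h + c * conj g` on the slit domain, with `h` and `g`
shifted generating functions. -/
def classHT (c : ℂ) : Set (ℂ → ℂ) :=
  {f | InnerProductSpace.HarmonicOnNhd f slitDomain ∧
    ∃ h ∈ shiftedT, ∃ g ∈ shiftedT, ∀ z ∈ slitDomain, f z = h z + c * conj (g z)}

/-- The `n`-th Taylor coefficient at the origin. -/
def taylorCoeff (f : ℂ → ℂ) (n : ℕ) : ℂ := iteratedDeriv n f 0 / (n.factorial : ℂ)

/-- The Hadamard product (convolution) on the unit disk of two functions holomorphic there. -/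
def hadamard (f g : ℂ → ℂ) (z : ℂ) : ℂ := ∑' n : ℕ, taylorCoeff f n * taylorCoeff g n * z ^ n

/-- The Wirtinger derivative `f_z = (f_x - i f_y) / 2`. -/
def dz (f : ℂ → ℂ) (z : ℂ) : ℂ :=
  (fderiv ℝ f z 1 - Complex.I * fderiv ℝ f z Complex.I) / 2

/-- The Wirtinger derivative `f_{z̄} = (f_x + i f_y) / 2`. -/
def dzbar (f : ℂ → ℂ) (z : ℂ) : ℂ :=
  (fderiv ℝ f z 1 + Complex.I * fderiv ℝ f z Complex.I) / 2

/-- The Jacobian `|f_z|² - |f_{z̄}|²`. -/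
def jacobian (f : ℂ → ℂ) (z : ℂ) : ℝ := ‖dz f z‖ ^ 2 - ‖dzbar f z‖ ^ 2

/-- The second complex dilatation `conj f_{z̄} / f_z`. -/
def secondDilatation (f : ℂ → ℂ) (z : ℂ) : ℂ := conj (dzbar f z) / dz f z

/-- `f` is a univalent harmonic mapping of `U`: harmonic, injective and sense-preserving
(for harmonic mappings, positive Jacobian). -/
structure IsUnivalentHarmonicOn (f : ℂ → ℂ) (U : Set ℂ) : Prop where
  harmonic : InnerProductSpace.HarmonicOnNhd f U
  injOn : Set.InjOn f U
  jacobian_pos : ∀ z ∈ U, 0 < jacobian f z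

/-- `f` is a `k`-quasiconformal harmonic mapping of `U`: univalent, with second complex
dilatation bounded by the constant `k < 1`. -/
structure IsQuasiconformalHarmonicOn (k : ℝ) (f : ℂ → ℂ) (U : Set ℂ) : Prop where
  lt_one : k < 1
  univalent : IsUnivalentHarmonicOn f U
  dilatation_le : ∀ z ∈ U, ‖secondDilatation f z‖ ≤ k

end HarmonicHausdorff

end

/-!
Writing `h(z) = z ∫ (1 - t z)⁻¹ dμ(t)` and `g(z) = z ∫ (1 - t z)⁻¹ dν(t)`, the Hadamard product
`H = h * g` is the function of the same kind belonging to the multiplicative convolution of `μ` and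
`ν` (`mulConv`, `hadamard_eq_of_eqOn`), because its coefficients are products of moments. This gives
the extension to the slit domain. Differentiating, `H'(z) = ∫ h'(s z) dν(s)`
(`cauchyKernelSq_mulConv`), so that `|c H'| ≤ c M |h'|`: the dilatation bound.

Injectivity of `f = h + c conj H` comes from the shear principle of Clunie and Sheil-Small
(`eq_of_re_eq_of_im_eq_of_ordConnected`). The functions `f` and `φ = h + c H` have the same real
part, while `Im f = Im ψ` for `ψ = h - c H`, and `Re (ψ' / φ') > 0` as `|c H'| < |h'|`. Hence `Im f`
increases strictly along every vertical segment in the image of `φ`, and it suffices that `φ` is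
univalent with image convex in the vertical direction.

Now `φ(z) = z ∫ (1 - t z)⁻¹ dρ(t)` for the positive measure `ρ = μ + c (mulConv μ ν)`, and
`Im (z φ') = ∫ Im z (1 - |t z|²) |1 - t z|⁻⁴ dρ(t) > 0` in the upper half disk. By a theorem of
Robertson this implies both properties (`IsRobertson.injOn`, `IsRobertson.ordConnected_slice`). For
the convexity, `Re φ` is strictly decreasing along upper semicircles, so a level set of `Re φ` in
the upper half disk meets each semicircle at most once and is a connected arc that starts on the
real axis (`IsRobertson.isPreconnected_levelArc`); its mirror image completes the level set.
-/

noncomputable section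

namespace HarmonicHausdorff

/-! ### The shear construction -/

theorem hasDerivAt_im_comp_vertical {G : ℂ → ℂ} {G' : ℂ} {u v : ℝ}
    (hG : HasDerivAt G G' (u + v * Complex.I)) :
    HasDerivAt (fun y : ℝ => (G (u + y * Complex.I)).im) G'.re v := by
  have hline : HasDerivAt (fun y : ℝ => (u + y * Complex.I : ℂ)) Complex.I v := by
    simpa using ((Complex.ofRealCLM.hasDerivAt (x := v)).mul_const Complex.I).const_add (u : ℂ)
  have h := Complex.imCLM.hasFDerivAt.comp_hasDerivAt v (hG.scomp v hline)
  simpa [Function.comp_def] using h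

/-- The shear principle of Clunie and Sheil-Small. If `φ` is univalent with image convex in the
vertical direction and `Re (ψ' / φ') > 0`, then `Re φ` and `Im ψ` together separate points: along a
vertical line, `Im (ψ ∘ φ⁻¹)` has derivative `Re (ψ' / φ')`, hence is strictly increasing. -/
theorem eq_of_re_eq_of_im_eq_of_ordConnected {U : Set ℂ} (hU : IsOpen U) {φ ψ : ℂ → ℂ}
    (hφ : DifferentiableOn ℂ φ U) (hψ : DifferentiableOn ℂ ψ U) (hinj : InjOn φ U)
    (h0 : ∀ z ∈ U, deriv φ z ≠ 0) (hre : ∀ z ∈ U, 0 < (deriv ψ z / deriv φ z).re)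
    (hconv : ∀ u : ℝ, {v : ℝ | (u + v * Complex.I : ℂ) ∈ φ '' U}.OrdConnected)
    {z w : ℂ} (hz : z ∈ U) (hw : w ∈ U) (h_re : (φ z).re = (φ w).re)
    (h_im : (ψ z).im = (ψ w).im) : z = w := by
  set g := Function.invFunOn φ U with hg
  have hgφ : ∀ x ∈ U, g (φ x) = x := fun x hx => hinj.leftInvOn_invFunOn hx
  have hder : ∀ x ∈ U, HasDerivAt (ψ ∘ g) (deriv ψ x / deriv φ x) (φ x) := by
    intro x hx
    have hUx := hU.mem_nhds hx
    have h1 : HasStrictDerivAt φ (deriv φ x) x := (hφ.analyticAt hUx).hasStrictDerivAt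
    have h2 : HasStrictDerivAt g (deriv φ x)⁻¹ (φ x) :=
      h1.to_local_left_inverse (h0 x hx) (by filter_upwards [hUx] with y hy using hgφ y hy)
    have h3 : HasDerivAt ψ (deriv ψ x) (g (φ x)) := by
      rw [hgφ x hx]; exact ((hψ x hx).differentiableAt hUx).hasDerivAt
    simpa [div_eq_mul_inv] using h3.comp (φ x) h2.hasDerivAt
  set u := (φ z).re with hu
  set V : Set ℝ := {v : ℝ | (u + v * Complex.I : ℂ) ∈ φ '' U} with hV
  have hq : ∀ v ∈ V, ∃ d : ℝ, 0 < d ∧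
      HasDerivAt (fun y : ℝ => ((ψ ∘ g) (u + y * Complex.I)).im) d v := by
    rintro v ⟨x, hx, hxv⟩
    refine ⟨_, hre x hx, hasDerivAt_im_comp_vertical ?_⟩
    rw [← hxv]
    exact hder x hx
  have hmono : StrictMonoOn (fun y : ℝ => ((ψ ∘ g) (u + y * Complex.I)).im) V := by
    refine strictMonoOn_of_deriv_pos (hconv u).convex ?_ ?_
    · intro v hv
      obtain ⟨d, -, hd⟩ := hq v hv
      exact hd.continuousAt.continuousWithinAt
    · intro v hv
      obtain ⟨d, hd0, hd⟩ := hq v (interior_subset hv)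
      rwa [hd.deriv]
  have ez : (u + (φ z).im * Complex.I : ℂ) = φ z := Complex.re_add_im _
  have ew : (u + (φ w).im * Complex.I : ℂ) = φ w := by rw [h_re]; exact Complex.re_add_im _
  have key := hmono.injOn (x₁ := (φ z).im) (x₂ := (φ w).im)
    (by rw [hV, mem_ofPred_eq, ez]; exact ⟨z, hz, rfl⟩)
    (by rw [hV, mem_ofPred_eq, ew]; exact ⟨w, hw, rfl⟩)
    (by simp only [ez, ew, Function.comp_apply, hgφ z hz, hgφ w hw, h_im])
  exact hinj hz hw (Complex.ext h_re key)

/-! ### Functions convex in the vertical direction -/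

/-- Robertson's analytic condition for convexity in the vertical direction, for functions on the
unit disk that are real on the real axis: `z * φ' z` maps the upper half of the disk into the upper
half-plane, and `φ` is increasing on `(-1, 1)`. Since `Re (i z φ') = -Im (z φ')`, it says that
`Re φ` decreases along upper semicircles centred at the origin. No value `φ 0` is prescribed, but
`map_conj` makes it real. -/
structure IsRobertson (φ : ℂ → ℂ) : Prop where
  diff : DifferentiableOn ℂ φ (ball 0 1)
  map_conj : ∀ z ∈ ball (0 : ℂ) 1, φ (conj z) = conj (φ z)
  im_pos : ∀ z ∈ ball (0 : ℂ) 1, 0 < z.im → 0 < (z * deriv φ z).im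
  re_pos : ∀ x : ℝ, |x| < 1 → 0 < (deriv φ x).re

namespace IsRobertson

theorem congr {φ χ : ℂ → ℂ} (hφ : IsRobertson φ) (h : EqOn χ φ (ball 0 1)) :
    IsRobertson χ where
  diff := hφ.diff.congr h
  map_conj := fun z hz => by rw [h hz, h (by simpa using hz), hφ.map_conj z hz]
  im_pos := fun z hz him => by
    rw [(h.eventuallyEq_of_mem (isOpen_ball.mem_nhds hz)).deriv_eq]
    exact hφ.im_pos z hz him
  re_pos := fun x hx => by
    rw [(h.eventuallyEq_of_mem (isOpen_ball.mem_nhds (by simpa using hx))).deriv_eq]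
    exact hφ.re_pos x hx

variable {φ : ℂ → ℂ} (hφ : IsRobertson φ)
include hφ

theorem hasDerivAt {z : ℂ} (hz : z ∈ ball (0 : ℂ) 1) : HasDerivAt φ (deriv φ z) z :=
  ((hφ.diff z hz).differentiableAt (isOpen_ball.mem_nhds hz)).hasDerivAt

theorem im_ofReal {x : ℝ} (hx : |x| < 1) : (φ x).im = 0 := by
  have h := hφ.map_conj x (by simpa using hx)
  rw [Complex.conj_ofReal] at h
  exact Complex.conj_eq_iff_im.1 h.symm

theorem strictMonoOn_re : StrictMonoOn (fun x : ℝ => (φ x).re) (Ioo (-1) 1) := by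
  have hd : ∀ x ∈ Ioo (-1 : ℝ) 1, HasDerivAt (fun x : ℝ => (φ x).re) (deriv φ x).re x :=
    fun x hx => (hφ.hasDerivAt (by simpa using abs_lt.2 hx)).real_of_complex
  refine strictMonoOn_of_deriv_pos (convex_Ioo _ _)
    (fun x hx => (hd x hx).continuousAt.continuousWithinAt) fun x hx => ?_
  rw [interior_Ioo] at hx
  rw [(hd x hx).deriv]
  exact hφ.re_pos x (abs_lt.2 hx)

/-- Along a radius, `r ∂/∂r Im φ = Im (z φ')`, so `Im φ` increases from its value `0` at the
origin. -/
theorem im_pos_of_im_pos {z : ℂ} (hz : z ∈ ball (0 : ℂ) 1) (him : 0 < z.im) : 0 < (φ z).im := by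
  have hmem : ∀ r ∈ Icc (0 : ℝ) 1, (r : ℂ) * z ∈ ball (0 : ℂ) 1 := by
    intro r hr
    simp only [mem_ball_zero_iff, norm_mul, Complex.norm_real, Real.norm_eq_abs,
      abs_of_nonneg hr.1] at hz ⊢
    exact (mul_le_of_le_one_left (norm_nonneg z) hr.2).trans_lt hz
  have hd : ∀ r ∈ Icc (0 : ℝ) 1, HasDerivAt (fun r : ℝ => (φ (r * z)).im)
      (z * deriv φ (r * z)).im r := by
    intro r hr
    have hline : HasDerivAt (fun y : ℝ => (y * z : ℂ)) z r := by
      simpa using (Complex.ofRealCLM.hasDerivAt (x := r)).mul_const z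
    simpa [Function.comp_def] using
      Complex.imCLM.hasFDerivAt.comp_hasDerivAt r ((hφ.hasDerivAt (hmem r hr)).scomp r hline)
  have hmono : StrictMonoOn (fun r : ℝ => (φ (r * z)).im) (Icc 0 1) := by
    refine strictMonoOn_of_deriv_pos (convex_Icc _ _)
      (fun x hx => (hd x hx).continuousAt.continuousWithinAt) fun r hr => ?_
    rw [interior_Icc] at hr
    have hr' := Ioo_subset_Icc_self hr
    rw [(hd r hr').deriv]
    have h := hφ.im_pos _ (hmem r hr') (by simpa using mul_pos hr.1 him)
    rw [mul_assoc, Complex.im_ofReal_mul] at h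
    exact pos_of_mul_pos_right h hr.1.le
  have h := hmono (left_mem_Icc.2 zero_le_one) (right_mem_Icc.2 zero_le_one) zero_lt_one
  have h0 := hφ.im_ofReal (x := 0) (by simp)
  simp only [Complex.ofReal_zero, zero_mul, Complex.ofReal_one, one_mul] at h h0
  rwa [h0] at h

theorem strictAntiOn_re_circle {r : ℝ} (hr0 : 0 < r) (hr1 : r < 1) :
    StrictAntiOn (fun θ : ℝ => (φ (circleMap 0 r θ)).re) (Icc 0 Real.pi) := by
  have hmem : ∀ θ, circleMap 0 r θ ∈ ball (0 : ℂ) 1 := fun θ => by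
    simpa [abs_of_pos hr0] using hr1
  have hd : ∀ θ : ℝ, HasDerivAt (fun θ : ℝ => (φ (circleMap 0 r θ)).re)
      (-(circleMap 0 r θ * deriv φ (circleMap 0 r θ)).im) θ := by
    intro θ
    have h := Complex.reCLM.hasFDerivAt.comp_hasDerivAt θ
      ((hφ.hasDerivAt (hmem θ)).scomp θ (hasDerivAt_circleMap 0 r θ))
    refine h.congr_deriv ?_
    simp [circleMap]
    ring
  refine strictAntiOn_of_deriv_neg (convex_Icc _ _)
      (fun x hx => (hd x).continuousAt.continuousWithinAt) fun θ hθ => ?_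
  rw [interior_Icc] at hθ
  rw [(hd θ).deriv, neg_lt_zero]
  refine hφ.im_pos _ (hmem θ) ?_
  simpa [circleMap, Complex.exp_im] using mul_pos hr0 (Real.sin_pos_of_mem_Ioo hθ)

/-- In the logarithmic coordinate `ζ = log z` the upper half disk becomes a convex half-strip on
which `φ ∘ exp` has the derivative `z φ'` of positive imaginary part; a difference quotient over a
segment then cannot vanish (the Noshiro-Warschawski argument). -/
theorem injOn_upper : InjOn φ {z ∈ ball (0 : ℂ) 1 | 0 < z.im} := by
  rintro z ⟨hz, hzi⟩ w ⟨hw, hwi⟩ heq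
  by_contra hne
  have hz0 : z ≠ 0 := by rintro rfl; simp at hzi
  have hw0 : w ≠ 0 := by rintro rfl; simp at hwi
  set a := Complex.log z with ha
  set δ := Complex.log w - a with hδ
  have hδ0 : δ ≠ 0 := by
    intro h
    apply hne
    rw [← Complex.exp_log hz0, ← Complex.exp_log hw0, sub_eq_zero.1 h]
  have hstrip : Convex ℝ {ζ : ℂ | ζ.re < 0 ∧ 0 < ζ.im ∧ ζ.im < Real.pi} := by
    refine (convex_halfSpace_re_lt 0).inter ((convex_halfSpace_im_gt 0).inter
      (convex_halfSpace_im_lt _))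
  have hlog : ∀ x ∈ ball (0 : ℂ) 1, 0 < x.im →
      Complex.log x ∈ {ζ : ℂ | ζ.re < 0 ∧ 0 < ζ.im ∧ ζ.im < Real.pi} := by
    intro x hx hxi
    have hx0 : x ≠ 0 := by rintro rfl; simp at hxi
    refine ⟨?_, ?_, ?_⟩
    · rw [Complex.log_re]
      exact Real.log_neg (norm_pos_iff.2 hx0) (by simpa using hx)
    · rw [Complex.log_im]
      refine lt_of_le_of_ne (Complex.arg_nonneg_iff.2 hxi.le) fun h => ?_
      exact hxi.ne' (Complex.arg_eq_zero_iff.1 h.symm).2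
    · rw [Complex.log_im]
      exact Complex.arg_lt_pi_iff.2 (Or.inr hxi.ne')
  have hexp : ∀ ζ ∈ {ζ : ℂ | ζ.re < 0 ∧ 0 < ζ.im ∧ ζ.im < Real.pi},
      Complex.exp ζ ∈ ball (0 : ℂ) 1 ∧ 0 < (Complex.exp ζ).im := by
    rintro ζ ⟨h1, h2, h3⟩
    refine ⟨by simpa [Complex.norm_exp] using h1, ?_⟩
    rw [Complex.exp_im]
    exact mul_pos (Real.exp_pos _) (Real.sin_pos_of_pos_of_lt_pi h2 h3)
  have hseg : ∀ τ ∈ Icc (0 : ℝ) 1, a + τ * δ ∈ {ζ : ℂ | ζ.re < 0 ∧ 0 < ζ.im ∧ ζ.im < Real.pi} := by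
    intro τ hτ
    have := hstrip.add_smul_sub_mem (hlog z hz hzi) (hlog w hw hwi) hτ
    simpa only [Complex.real_smul] using this
  have hd : ∀ τ ∈ Icc (0 : ℝ) 1, HasDerivAt (fun τ : ℝ => (φ (Complex.exp (a + τ * δ)) / δ).im)
      (Complex.exp (a + τ * δ) * deriv φ (Complex.exp (a + τ * δ))).im τ := by
    intro τ hτ
    have hline : HasDerivAt (fun y : ℝ => (a + y * δ : ℂ)) δ τ := by
      simpa using ((Complex.ofRealCLM.hasDerivAt (x := τ)).mul_const δ).const_add a
    have h1 := (hφ.hasDerivAt (hexp _ (hseg τ hτ)).1).comp _ (Complex.hasDerivAt_exp (a + τ * δ))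
    have h2 := Complex.imCLM.hasFDerivAt.comp_hasDerivAt τ ((h1.scomp τ hline).div_const δ)
    refine h2.congr_deriv ?_
    simp only [smul_eq_mul, Complex.imCLM_apply]
    congr 1
    field_simp
  have hmono : StrictMonoOn (fun τ : ℝ => (φ (Complex.exp (a + τ * δ)) / δ).im) (Icc 0 1) := by
    refine strictMonoOn_of_deriv_pos (convex_Icc _ _)
      (fun x hx => (hd x hx).continuousAt.continuousWithinAt) fun r hr => ?_
    have hr' := interior_subset hr
    rw [(hd r hr').deriv]
    obtain ⟨h1, h2⟩ := hexp _ (hseg r hr')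
    exact hφ.im_pos _ h1 h2
  have h := hmono (left_mem_Icc.2 zero_le_one) (right_mem_Icc.2 zero_le_one) zero_lt_one
  have h2 : a + δ = Complex.log w := by rw [hδ]; ring
  simp only [Complex.ofReal_zero, zero_mul, add_zero, Complex.ofReal_one, one_mul, h2] at h
  rw [ha, Complex.exp_log hz0, Complex.exp_log hw0, heq] at h
  exact lt_irrefl _ h

theorem im_neg_of_im_neg {z : ℂ} (hz : z ∈ ball (0 : ℂ) 1) (him : z.im < 0) : (φ z).im < 0 := by
  have h := hφ.im_pos_of_im_pos (z := conj z) (by simpa using hz) (by simpa using him)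
  rw [hφ.map_conj z hz] at h
  simpa using h

/-- `Im φ` has the sign of `Im z`, so injectivity may be checked separately on the upper half disk,
the lower half disk and the real diameter. -/
theorem injOn : InjOn φ (ball (0 : ℂ) 1) := by
  have hzero : ∀ z ∈ ball (0 : ℂ) 1, z.im = 0 → (φ z).im = 0 := by
    intro z hz h
    have := hφ.im_ofReal (x := z.re) ((Complex.abs_re_le_norm z).trans_lt (by simpa using hz))
    rwa [show ((z.re : ℝ) : ℂ) = z from Complex.ext rfl (by simp [h])] at this
  intro z hz w hw heq
  rcases lt_trichotomy z.im 0 with h | h | h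
  · have h1 := hφ.im_neg_of_im_neg hz h
    rw [heq] at h1
    have h2 : w.im < 0 := by
      by_contra! hc
      rcases hc.eq_or_lt with hc | hc
      · exact h1.ne (hzero w hw hc.symm)
      · exact absurd (hφ.im_pos_of_im_pos hw hc) h1.not_gt
    have := hφ.injOn_upper (x₁ := conj z) (x₂ := conj w) ⟨by simpa using hz, by simpa using h⟩
      ⟨by simpa using hw, by simpa using h2⟩
      (by rw [hφ.map_conj z hz, hφ.map_conj w hw, heq])
    exact star_injective this
  · have h1 := hzero z hz h
    rw [heq] at h1
    have h2 : w.im = 0 := by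
      rcases lt_trichotomy w.im 0 with hc | hc | hc
      · exact absurd h1 (hφ.im_neg_of_im_neg hw hc).ne
      · exact hc
      · exact absurd h1 (hφ.im_pos_of_im_pos hw hc).ne'
    have ez : ((z.re : ℝ) : ℂ) = z := Complex.ext rfl (by simp [h])
    have ew : ((w.re : ℝ) : ℂ) = w := Complex.ext rfl (by simp [h2])
    have := hφ.strictMonoOn_re.injOn (x₁ := z.re) (x₂ := w.re)
      (abs_lt.1 ((Complex.abs_re_le_norm z).trans_lt (by simpa using hz)))
      (abs_lt.1 ((Complex.abs_re_le_norm w).trans_lt (by simpa using hw)))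
      (by simp only [ez, ew, heq])
    rw [← ez, ← ew, this]
  · have h1 := hφ.im_pos_of_im_pos hz h
    rw [heq] at h1
    have h2 : 0 < w.im := by
      by_contra! hc
      rcases hc.eq_or_lt with hc | hc
      · exact h1.ne' (hzero w hw hc)
      · exact absurd (hφ.im_neg_of_im_neg hw hc) h1.not_gt
    exact hφ.injOn_upper ⟨hz, h⟩ ⟨hw, h2⟩ heq

theorem deriv_ne_zero {z : ℂ} (hz : z ∈ ball (0 : ℂ) 1) : deriv φ z ≠ 0 := by
  intro h0
  rcases lt_trichotomy z.im 0 with h | h | h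
  · have hz' : conj z ∈ ball (0 : ℂ) 1 := by simpa using hz
    have h1 := hφ.im_pos (conj z) hz' (by simpa using h)
    have h2 : (conj ∘ φ ∘ conj) =ᶠ[𝓝 (conj z)] φ := by
      filter_upwards [isOpen_ball.mem_nhds hz'] with x hx
      simp [hφ.map_conj x hx]
    rw [← h2.deriv_eq, deriv_conj_conj] at h1
    simp [h0] at h1
  · have := hφ.re_pos z.re ((Complex.abs_re_le_norm z).trans_lt (by simpa using hz))
    rw [show ((z.re : ℝ) : ℂ) = z from Complex.ext rfl (by simp [h]), h0] at this
    simp at this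
  · have := hφ.im_pos z hz h
    simp [h0] at this

/-- Every semicircle of radius between `|x₀|` and `‖z‖` meets the level set of `Re φ` through `x₀`
and `z`: the values of `Re φ` at its two end points enclose the level. -/
theorem exists_re_eq_of_norm {z : ℂ} {x₀ : ℝ} (hz : z ∈ ball (0 : ℂ) 1)
    (hx : (φ x₀).re = (φ z).re) {r : ℝ} (hr : r ∈ Icc |x₀| ‖z‖) :
    ∃ w : ℂ, ‖w‖ = r ∧ 0 ≤ w.im ∧ (φ w).re = (φ z).re := by
  have hz1 : ‖z‖ < 1 := by simpa using hz
  have hr1 : r < 1 := hr.2.trans_lt hz1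
  have hr0 : 0 ≤ r := (abs_nonneg _).trans hr.1
  have hcont : ContinuousOn (fun θ : ℝ => (φ (circleMap 0 r θ)).re) (Icc 0 Real.pi) := by
    refine Complex.continuous_re.comp_continuousOn (hφ.diff.continuousOn.comp
      (continuous_circleMap 0 r).continuousOn fun θ _ => ?_)
    simpa [abs_of_nonneg hr0] using hr1
  have hmem := abs_le.1 hr.1
  have hmono := hφ.strictMonoOn_re.monotoneOn
  have h1 := hmono (a := -r) (b := x₀) ⟨by linarith, by linarith⟩
    ⟨by linarith, by linarith⟩ hmem.1
  have h2 := hmono (a := x₀) (b := r) ⟨by linarith, by linarith⟩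
    ⟨by linarith, by linarith⟩ hmem.2
  have hivt : (φ z).re ∈ (fun θ : ℝ => (φ (circleMap 0 r θ)).re) '' Icc 0 Real.pi :=
    intermediate_value_Icc' Real.pi_pos.le hcont
      ⟨by simpa [circleMap, hx] using h1, by simpa [circleMap, hx] using h2⟩
  obtain ⟨θ, hθ, h⟩ := hivt
  refine ⟨circleMap 0 r θ, by simp [abs_of_nonneg hr0], ?_, h⟩
  simpa [circleMap, Complex.exp_im] using mul_nonneg hr0 (Real.sin_nonneg_of_mem_Icc hθ)

theorem eq_of_norm_eq_of_re_eq {z w : ℂ} (hz : z ∈ ball (0 : ℂ) 1) (hzi : 0 ≤ z.im)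
    (hwi : 0 ≤ w.im) (hn : ‖w‖ = ‖z‖) (hre : (φ w).re = (φ z).re) : w = z := by
  rcases eq_or_ne z 0 with rfl | hz0
  · simpa using hn
  have key : ∀ x : ℂ, 0 ≤ x.im → x.arg ∈ Icc 0 Real.pi := fun x hx =>
    ⟨Complex.arg_nonneg_iff.2 hx, Complex.arg_le_pi x⟩
  have hpolar : ∀ x : ℂ, circleMap 0 ‖x‖ x.arg = x := fun x => by
    simp [circleMap]
  have h := (hφ.strictAntiOn_re_circle (norm_pos_iff.2 hz0) (by simpa using hz)).injOn
    (key w hwi) (key z hzi) (by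
      have := hpolar w
      rw [hn] at this
      simpa only [hpolar, this] using hre)
  rw [← hpolar w, ← hpolar z, h, hn]

theorem exists_real_re_eq {z : ℂ} (hz : z ∈ ball (0 : ℂ) 1) (hzi : 0 ≤ z.im) :
    ∃ x₀ : ℝ, |x₀| ≤ ‖z‖ ∧ (φ x₀).re = (φ z).re := by
  have hz1 : ‖z‖ < 1 := by simpa using hz
  rcases eq_or_ne z 0 with rfl | hz0
  · exact ⟨0, by simp⟩
  have hcont : ContinuousOn (fun x : ℝ => (φ x).re) (Icc (-‖z‖) ‖z‖) := by
    refine Complex.continuous_re.comp_continuousOn (hφ.diff.continuousOn.comp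
      Complex.continuous_ofReal.continuousOn fun x hx => ?_)
    simpa using (abs_le.2 hx).trans_lt hz1
  have hanti := (hφ.strictAntiOn_re_circle (norm_pos_iff.2 hz0) hz1).antitoneOn
  have harg : z.arg ∈ Icc 0 Real.pi := ⟨Complex.arg_nonneg_iff.2 hzi, Complex.arg_le_pi z⟩
  have h1 := hanti harg (right_mem_Icc.2 Real.pi_pos.le) harg.2
  have h2 := hanti (left_mem_Icc.2 Real.pi_pos.le) harg harg.1
  have hpolar : circleMap 0 ‖z‖ z.arg = z := by simp [circleMap]
  simp only [hpolar] at h1 h2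
  have hivt : (φ z).re ∈ (fun x : ℝ => (φ x).re) '' Icc (-‖z‖) ‖z‖ :=
    intermediate_value_Icc (by linarith [norm_nonneg z]) hcont
      ⟨by simpa [circleMap] using h1, by simpa [circleMap] using h2⟩
  obtain ⟨x, hx, h⟩ := hivt
  exact ⟨x, abs_le.2 hx, h⟩

/-- In the closed upper half disk, the part of a level set of `Re φ` between the radii `|x₀|` and
`‖z‖` is connected: it is compact and meets each semicircle in exactly one point, so the modulus is
a homeomorphism of it onto an interval. -/
theorem isPreconnected_levelArc {z : ℂ} {x₀ : ℝ} (hz : z ∈ ball (0 : ℂ) 1)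
    (hx : (φ x₀).re = (φ z).re) :
    IsPreconnected {w : ℂ | ‖w‖ ∈ Icc |x₀| ‖z‖ ∧ 0 ≤ w.im ∧ (φ w).re = (φ z).re} := by
  have hz1 : ‖z‖ < 1 := by simpa using hz
  set K := {w : ℂ | ‖w‖ ∈ Icc |x₀| ‖z‖ ∧ 0 ≤ w.im ∧ (φ w).re = (φ z).re} with hK
  have hsub : closedBall (0 : ℂ) ‖z‖ ⊆ ball 0 1 := closedBall_subset_ball hz1
  have hclosed : IsClosed {w ∈ closedBall (0 : ℂ) ‖z‖ | (φ w).re = (φ z).re} :=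
    (Complex.continuous_re.comp_continuousOn
      (hφ.diff.continuousOn.mono hsub)).preimage_isClosed_of_isClosed isClosed_closedBall
      (isClosed_singleton (x := (φ z).re))
  have hKeq : K = {w ∈ closedBall (0 : ℂ) ‖z‖ | (φ w).re = (φ z).re} ∩
      ({w : ℂ | |x₀| ≤ ‖w‖} ∩ {w : ℂ | 0 ≤ w.im}) := by
    ext w
    simp only [hK, mem_Icc, mem_ofPred_eq, mem_inter_iff, mem_closedBall_zero_iff]
    tauto
  have hKc : IsCompact K := by
    refine (isCompact_closedBall (0 : ℂ) ‖z‖).of_isClosed_subset ?_ fun w hw => by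
      simpa using hw.1.2
    rw [hKeq]
    exact hclosed.inter ((isClosed_le continuous_const continuous_norm).inter
      (isClosed_le continuous_const Complex.continuous_im))
  have : CompactSpace K := isCompact_iff_compactSpace.1 hKc
  let N : K → ℝ := fun w => ‖(w : ℂ)‖
  have hN : Continuous N := by fun_prop
  have hinj : Function.Injective N := by
    rintro ⟨v, hv⟩ ⟨w, hw⟩ h
    have hwb : w ∈ ball (0 : ℂ) 1 := by simpa using hw.1.2.trans_lt hz1
    exact Subtype.ext (hφ.eq_of_norm_eq_of_re_eq hwb hw.2.1 hv.2.1 h (hv.2.2.trans hw.2.2.symm))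
  have hrange : Icc |x₀| ‖z‖ ⊆ range N := by
    intro r hr
    obtain ⟨w, hw, hwi, hwr⟩ := hφ.exists_re_eq_of_norm hz hx hr
    exact ⟨⟨w, by rwa [hw], hwi, hwr⟩, hw⟩
  have hpre := isPreconnected_Icc.preimage_of_isClosedMap hinj hN.isClosedMap hrange
  have himg := hpre.image ((↑) : K → ℂ) continuous_subtype_val.continuousOn
  convert himg using 1
  ext w
  simp only [mem_image, mem_preimage, Subtype.exists, exists_and_left, exists_prop,
    exists_eq_right_right, N]
  exact ⟨fun h => ⟨h.1, h⟩, fun h => h.2⟩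

/-- The image of the disk is convex in the vertical direction: vertical lines meet it in intervals.
This is the geometric half of Robertson's theorem. -/
theorem ordConnected_slice (u : ℝ) :
    {v : ℝ | (u + v * Complex.I : ℂ) ∈ φ '' ball 0 1}.OrdConnected := by
  set V := {v : ℝ | (u + v * Complex.I : ℂ) ∈ φ '' ball 0 1} with hV
  have hmemV : ∀ z ∈ ball (0 : ℂ) 1, (φ z).re = u → (φ z).im ∈ V := by
    intro z hz h
    exact ⟨z, hz, by rw [← h]; exact (Complex.re_add_im _).symm⟩
  have hneg : ∀ v ∈ V, -v ∈ V := by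
    rintro v ⟨z, hz, h⟩
    refine ⟨conj z, by simpa using hz, ?_⟩
    rw [hφ.map_conj z hz, h]
    simp
  -- An arc of the level set of `Re φ` joins `z` to the real axis, where `Im φ = 0`; on this arc
  -- `Im φ` takes all values between `0` and `v`.
  have hpos : ∀ v ∈ V, 0 ≤ v → Icc 0 v ⊆ V := by
    rintro v ⟨z, hz, h⟩ hv
    have hre : (φ z).re = u := by simp [h]
    have him : (φ z).im = v := by simp [h]
    have hzi : 0 ≤ z.im := by
      by_contra! hc
      exact absurd (hφ.im_neg_of_im_neg hz hc) (by rw [him]; exact hv.not_gt)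
    obtain ⟨x₀, hx₀, hx⟩ := hφ.exists_real_re_eq hz hzi
    have hz1 : ‖z‖ < 1 := by simpa using hz
    have hKsub : {w : ℂ | ‖w‖ ∈ Icc |x₀| ‖z‖ ∧ 0 ≤ w.im ∧ (φ w).re = (φ z).re} ⊆ ball 0 1 :=
      fun w hw => by simpa using hw.1.2.trans_lt hz1
    have hpc := (hφ.isPreconnected_levelArc hz hx).image (fun w => (φ w).im)
      (Complex.continuous_im.comp_continuousOn (hφ.diff.continuousOn.mono hKsub))
    have h0 : (φ x₀).im = 0 := hφ.im_ofReal (hx₀.trans_lt hz1)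
    refine (hpc.ordConnected.out ⟨x₀, ⟨by simpa using hx₀, by simp, hx⟩, h0⟩
      ⟨z, ⟨⟨hx₀, le_rfl⟩, hzi, rfl⟩, him⟩).trans ?_
    rintro _ ⟨w, hw, rfl⟩
    exact hmemV w (hKsub hw) (hw.2.2.trans hre)
  refine ⟨fun a ha b hb y hy => ?_⟩
  rcases le_total 0 y with h | h
  · exact hpos b hb (h.trans hy.2) ⟨h, hy.2⟩
  · have := hneg _ (hpos (-a) (hneg a ha) (by linarith [hy.1]) (a := -y)
      ⟨by linarith, by linarith [hy.1]⟩)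
    rwa [neg_neg] at this

end IsRobertson

/-! ### The slit domain -/

theorem one_sub_mul_ne_zero {z : ℂ} (hz : z ∈ slitDomain) (t : unitInterval) :
    1 - (t : ℂ) * z ≠ 0 := by
  intro h
  have ht0 : (t : ℝ) ≠ 0 := by
    intro h0
    simp [h0] at h
  have ht : 0 < (t : ℝ) := lt_of_le_of_ne t.2.1 ht0.symm
  refine hz (t : ℝ)⁻¹ ((one_le_inv₀ ht).2 t.2.2) ?_
  have : ((t : ℝ) : ℂ) ≠ 0 := by exact_mod_cast ht0
  push_cast
  field_simp
  linear_combination -h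

theorem unitDisk_subset_slitDomain : unitDisk ⊆ slitDomain := by
  rintro z hz x hx rfl
  have : |x| < 1 := by simpa [unitDisk] using hz
  linarith [le_abs_self x]

theorem isOpen_slitDomain : IsOpen slitDomain := by
  have : slitDomain = (Complex.ofReal '' Ici 1)ᶜ := by
    ext z
    simp only [slitDomain, mem_ofPred_eq, mem_compl_iff, mem_image, mem_Ici, not_exists, not_and]
    exact ⟨fun h x hx hxz => h x hx hxz.symm, fun h x hx hxz => h x hx hxz.symm⟩
  rw [this]
  exact (Complex.isUniformEmbedding_ofReal.isClosedEmbedding.isClosedMap _ isClosed_Ici).isOpen_compl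

theorem mul_mem_unitDisk {z : ℂ} (hz : z ∈ unitDisk) (t : unitInterval) :
    (t : ℂ) * z ∈ unitDisk := by
  have h : ‖z‖ < 1 := by simpa [unitDisk] using hz
  simp only [unitDisk, mem_ball_zero_iff, norm_mul, Complex.norm_real, Real.norm_eq_abs,
    abs_of_nonneg t.2.1]
  exact (mul_le_of_le_one_left (norm_nonneg z) t.2.2).trans_lt h

/-! ### Cauchy transforms of measures on the unit interval -/

/-- The function `z ↦ ∫ (1 - t z)⁻¹ dμ(t)`, holomorphic on the slit domain, whose Taylor
coefficients at the origin are the moments of `μ`. -/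
def cauchyTransform (μ : Measure unitInterval) (z : ℂ) : ℂ := ∫ t, (1 - (t : ℂ) * z)⁻¹ ∂μ

/-- The integral `∫ (1 - t z)⁻² dμ(t)`: the derivative of `z ↦ z * cauchyTransform μ z`. -/
def cauchyKernelSq (μ : Measure unitInterval) (z : ℂ) : ℂ := ∫ t, ((1 - (t : ℂ) * z) ^ 2)⁻¹ ∂μ

theorem continuous_inv_one_sub {z : ℂ} (hz : z ∈ slitDomain) :
    Continuous fun t : unitInterval => (1 - (t : ℂ) * z)⁻¹ :=
  Continuous.inv₀ (by fun_prop) (one_sub_mul_ne_zero hz)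

theorem _root_.Continuous.integrable_unitInterval {E : Type*} [NormedAddCommGroup E]
    {μ : Measure unitInterval} [IsFiniteMeasure μ] {f : unitInterval → E} (hf : Continuous f) :
    Integrable f μ :=
  hf.integrable_of_hasCompactSupport (HasCompactSupport.of_compactSpace f)

theorem continuous_inv_one_sub_sq {z : ℂ} (hz : z ∈ slitDomain) :
    Continuous fun t : unitInterval => ((1 - (t : ℂ) * z) ^ 2)⁻¹ := by
  simp only [← inv_pow]
  exact (continuous_inv_one_sub hz).pow 2

theorem hasDerivAt_cauchyTransform (μ : Measure unitInterval) [IsFiniteMeasure μ] {z : ℂ}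
    (hz : z ∈ slitDomain) :
    HasDerivAt (cauchyTransform μ) (∫ t, (t : ℂ) * ((1 - (t : ℂ) * z) ^ 2)⁻¹ ∂μ) z := by
  -- `1 - t z` stays away from `0` uniformly in `t`, by compactness, and for nearby points too.
  obtain ⟨t₀, -, ht₀⟩ := isCompact_univ.exists_isMinOn (s := (univ : Set unitInterval))
    univ_nonempty (f := fun t => ‖1 - (t : ℂ) * z‖) (by fun_prop)
  set m := ‖1 - (t₀ : ℂ) * z‖ with hm
  have hm0 : 0 < m := norm_pos_iff.2 (one_sub_mul_ne_zero hz t₀)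
  have hbound : ∀ t : unitInterval, ∀ x ∈ ball z (m / 2), m / 2 ≤ ‖1 - (t : ℂ) * x‖ := by
    intro t x hx
    have h1 : m ≤ ‖1 - (t : ℂ) * z‖ := ht₀ (mem_univ t)
    have h2 : ‖(t : ℂ) * (x - z)‖ ≤ m / 2 := by
      rw [norm_mul, Complex.norm_real, Real.norm_eq_abs, abs_of_nonneg t.2.1]
      rw [mem_ball, dist_eq_norm] at hx
      exact (mul_le_of_le_one_left (norm_nonneg _) t.2.2).trans hx.le
    have h3 := norm_add_le (1 - (t : ℂ) * x) ((t : ℂ) * (x - z))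
    rw [show 1 - (t : ℂ) * x + (t : ℂ) * (x - z) = 1 - (t : ℂ) * z by ring] at h3
    linarith
  refine (hasDerivAt_integral_of_dominated_loc_of_deriv_le (μ := μ)
    (F := fun x (t : unitInterval) => (1 - (t : ℂ) * x)⁻¹)
    (F' := fun x (t : unitInterval) => (t : ℂ) * ((1 - (t : ℂ) * x) ^ 2)⁻¹)
    (bound := fun _ => ((m / 2) ^ 2)⁻¹) (ball_mem_nhds z (half_pos hm0)) ?_ ?_ ?_ ?_ ?_ ?_).2
  · filter_upwards [isOpen_slitDomain.mem_nhds hz] with x hx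
    exact (continuous_inv_one_sub hx).aestronglyMeasurable
  · exact (continuous_inv_one_sub hz).integrable_unitInterval
  · exact (Continuous.mul (by fun_prop) (continuous_inv_one_sub_sq hz)).aestronglyMeasurable
  · refine .of_forall fun t x hx => ?_
    rw [norm_mul, Complex.norm_real, Real.norm_eq_abs, abs_of_nonneg t.2.1, norm_inv, norm_pow]
    refine (mul_le_of_le_one_left (by positivity) t.2.2).trans ?_
    have := hbound t x hx
    gcongr
  · exact integrable_const _
  · refine .of_forall fun t x hx => ?_
    have hne : 1 - (t : ℂ) * x ≠ 0 := norm_pos_iff.1 ((half_pos hm0).trans_le (hbound t x hx))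
    have h := (((hasDerivAt_id x).const_mul (t : ℂ)).const_sub 1).inv hne
    refine h.congr_deriv ?_
    simp [div_eq_mul_inv]

theorem differentiableOn_cauchyTransform (μ : Measure unitInterval) [IsFiniteMeasure μ] :
    DifferentiableOn ℂ (cauchyTransform μ) slitDomain := fun _ hz =>
  (hasDerivAt_cauchyTransform μ hz).differentiableAt.differentiableWithinAt

theorem hasDerivAt_id_mul_cauchyTransform (μ : Measure unitInterval) [IsFiniteMeasure μ] {z : ℂ}
    (hz : z ∈ slitDomain) :
    HasDerivAt (fun z => z * cauchyTransform μ z) (cauchyKernelSq μ z) z := by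
  refine ((hasDerivAt_id z).mul (hasDerivAt_cauchyTransform μ hz)).congr_deriv ?_
  have h1 := (continuous_inv_one_sub hz).integrable_unitInterval (μ := μ)
  have h2 : Integrable (fun t : unitInterval => (t : ℂ) * ((1 - (t : ℂ) * z) ^ 2)⁻¹) μ :=
    (Continuous.mul (by fun_prop) (continuous_inv_one_sub_sq hz)).integrable_unitInterval
  rw [one_mul, id, cauchyTransform, cauchyKernelSq, ← integral_const_mul,
    ← integral_add h1 (h2.const_mul z)]
  refine integral_congr_ae (.of_forall fun t => ?_)
  have := one_sub_mul_ne_zero hz t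
  field_simp
  ring

theorem hasSum_cauchyTransform (μ : Measure unitInterval) [IsFiniteMeasure μ] {z : ℂ}
    (hz : z ∈ unitDisk) :
    HasSum (fun n : ℕ => ((∫ t, (t : ℝ) ^ n ∂μ : ℝ) : ℂ) * z ^ n) (cauchyTransform μ z) := by
  have hz1 : ‖z‖ < 1 := by simpa [unitDisk] using hz
  have hint : ∀ n : ℕ, Integrable (fun t : unitInterval => (((t : ℝ) : ℂ) * z) ^ n) μ := fun n =>
    Continuous.integrable_unitInterval (by fun_prop)
  have hle : ∀ n : ℕ, ∀ t : unitInterval, ‖((t : ℂ) * z) ^ n‖ ≤ ‖z‖ ^ n := by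
    intro n t
    rw [norm_pow, norm_mul, Complex.norm_real, Real.norm_eq_abs, abs_of_nonneg t.2.1]
    have := t.2.1
    gcongr
    exact mul_le_of_le_one_left (norm_nonneg _) t.2.2
  have hsum : Summable fun n : ℕ => ∫ t : unitInterval, ‖((t : ℂ) * z) ^ n‖ ∂μ := by
    refine Summable.of_nonneg_of_le (fun n => integral_nonneg fun t => norm_nonneg _)
      (fun n => integral_mono (hint n).norm (integrable_const (‖z‖ ^ n)) (hle n)) ?_
    simp only [integral_const, smul_eq_mul]
    exact (summable_geometric_of_lt_one (norm_nonneg z) hz1).mul_left _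
  have h := hasSum_integral_of_summable_integral_norm hint hsum
  have e1 : ∀ n : ℕ, ∫ t : unitInterval, ((t : ℂ) * z) ^ n ∂μ
      = ((∫ t : unitInterval, (t : ℝ) ^ n ∂μ : ℝ) : ℂ) * z ^ n := by
    intro n
    rw [← integral_complex_ofReal, ← integral_mul_const]
    simp [mul_pow]
  simp only [e1] at h
  have e2 : cauchyTransform μ z = ∫ t : unitInterval, ∑' n : ℕ, ((t : ℂ) * z) ^ n ∂μ := by
    refine integral_congr_ae (.of_forall fun t => ?_)
    exact (tsum_geometric_of_norm_lt_one (by simpa [unitDisk] using mul_mem_unitDisk hz t)).symm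
  rwa [e2]

theorem cauchyTransform_conj (μ : Measure unitInterval) (z : ℂ) :
    cauchyTransform μ (conj z) = conj (cauchyTransform μ z) := by
  simp only [cauchyTransform]
  rw [← integral_conj]
  simp

/-- The integrand has imaginary part `Im z * (1 - |t z|²) / |1 - t z|⁴ > 0`. -/
theorem im_mul_cauchyKernelSq_pos (μ : Measure unitInterval) [IsFiniteMeasure μ] (hμ : μ ≠ 0)
    {z : ℂ} (hz : z ∈ unitDisk) (him : 0 < z.im) : 0 < (z * cauchyKernelSq μ z).im := by
  have hcont := continuous_inv_one_sub_sq (unitDisk_subset_slitDomain hz)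
  have hint : Integrable (fun t : unitInterval => z * ((1 - (t : ℂ) * z) ^ 2)⁻¹) μ :=
    (Continuous.mul (by fun_prop) hcont).integrable_unitInterval
  have hpos : ∀ t : unitInterval, 0 < (z * ((1 - (t : ℂ) * z) ^ 2)⁻¹).im := by
    intro t
    have hne : 0 < Complex.normSq (1 - (t : ℂ) * z) :=
      Complex.normSq_pos.2 (one_sub_mul_ne_zero (unitDisk_subset_slitDomain hz) t)
    have hlt : Complex.normSq ((t : ℂ) * z) < 1 := by
      have : ‖(t : ℂ) * z‖ < 1 := by simpa [unitDisk] using mul_mem_unitDisk hz t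
      rw [Complex.normSq_eq_norm_sq]
      exact pow_lt_one₀ (norm_nonneg _) this two_ne_zero
    have e : (z * ((1 - (t : ℂ) * z) ^ 2)⁻¹).im
        = z.im * (1 - Complex.normSq ((t : ℂ) * z)) / Complex.normSq (1 - (t : ℂ) * z) ^ 2 := by
      rw [Complex.inv_def, map_pow, ← mul_assoc, Complex.im_mul_ofReal, div_eq_mul_inv, map_pow]
      congr 1
      simp [pow_two, Complex.normSq_apply]
      ring
    rw [e]
    have := sub_pos.2 hlt
    positivity
  rw [cauchyKernelSq, ← integral_const_mul]
  have e : (∫ t : unitInterval, z * ((1 - (t : ℂ) * z) ^ 2)⁻¹ ∂μ).im =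
      ∫ t : unitInterval, (z * ((1 - (t : ℂ) * z) ^ 2)⁻¹).im ∂μ :=
    (Complex.imCLM.integral_comp_comm hint).symm
  rw [e, integral_pos_iff_support_of_nonneg (fun t => (hpos t).le) hint.im]
  have : Function.support (fun t : unitInterval => (z * ((1 - (t : ℂ) * z) ^ 2)⁻¹).im) = univ :=
    eq_univ_of_forall fun t => (hpos t).ne'
  rw [this]
  exact Measure.measure_univ_pos.2 hμ

theorem re_cauchyKernelSq_ofReal_pos (μ : Measure unitInterval) [IsFiniteMeasure μ] (hμ : μ ≠ 0)
    {x : ℝ} (hx : |x| < 1) : 0 < (cauchyKernelSq μ x).re := by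
  have hz : (x : ℂ) ∈ slitDomain := unitDisk_subset_slitDomain (by simpa [unitDisk] using hx)
  have hne : ∀ t : unitInterval, 1 - (t : ℝ) * x ≠ 0 := fun t => by
    exact_mod_cast one_sub_mul_ne_zero hz t
  have e : cauchyKernelSq μ x = ((∫ t : unitInterval, ((1 - (t : ℝ) * x) ^ 2)⁻¹ ∂μ : ℝ) : ℂ) := by
    rw [cauchyKernelSq, ← integral_complex_ofReal]
    simp
  have hpos : ∀ t : unitInterval, 0 < ((1 - (t : ℝ) * x) ^ 2)⁻¹ := fun t => by
    have := hne t
    positivity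
  have hint : Integrable (fun t : unitInterval => ((1 - (t : ℝ) * x) ^ 2)⁻¹) μ :=
    Continuous.integrable_unitInterval
      (Continuous.inv₀ (by fun_prop) fun t => pow_ne_zero 2 (hne t))
  rw [e, Complex.ofReal_re, integral_pos_iff_support_of_nonneg (fun t => (hpos t).le) hint]
  have : Function.support (fun t : unitInterval => ((1 - (t : ℝ) * x) ^ 2)⁻¹) = univ :=
    eq_univ_of_forall fun t => (hpos t).ne'
  rw [this]
  exact Measure.measure_univ_pos.2 hμ

theorem isRobertson_id_mul_cauchyTransform (μ : Measure unitInterval) [IsFiniteMeasure μ]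
    (hμ : μ ≠ 0) : IsRobertson fun z => z * cauchyTransform μ z where
  diff := fun z hz => (hasDerivAt_id_mul_cauchyTransform μ
    (unitDisk_subset_slitDomain hz)).differentiableAt.differentiableWithinAt
  map_conj := fun z _ => by simp [cauchyTransform_conj]
  im_pos := fun z hz him => by
    rw [(hasDerivAt_id_mul_cauchyTransform μ (unitDisk_subset_slitDomain hz)).deriv]
    exact im_mul_cauchyKernelSq_pos μ hμ hz him
  re_pos := fun x hx => by
    rw [(hasDerivAt_id_mul_cauchyTransform μ
      (unitDisk_subset_slitDomain (by simpa [unitDisk] using hx))).deriv]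
    exact re_cauchyKernelSq_ofReal_pos μ hμ hx

/-! ### Multiplicative convolution -/

/-- The multiplicative convolution of two measures on the unit interval: the law of `s * t` under
`μ.prod ν`. Its moments are the products of the moments of `μ` and `ν`. -/
def mulConv (μ ν : Measure unitInterval) : Measure unitInterval :=
  (μ.prod ν).map fun p => p.1 * p.2

instance (μ ν : Measure unitInterval) [IsFiniteMeasure μ] [IsFiniteMeasure ν] :
    IsFiniteMeasure (mulConv μ ν) := by unfold mulConv; infer_instance

theorem integral_mulConv (μ ν : Measure unitInterval) [IsFiniteMeasure μ] [IsFiniteMeasure ν]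
    {E : Type*} [NormedAddCommGroup E] [NormedSpace ℝ E] {f : unitInterval → E}
    (hf : Continuous f) :
    ∫ t, f t ∂(mulConv μ ν) = ∫ s, ∫ t, f (t * s) ∂μ ∂ν := by
  have hmul : Continuous fun p : unitInterval × unitInterval => p.1 * p.2 := by fun_prop
  have hint : Integrable (fun p : unitInterval × unitInterval => f (p.1 * p.2)) (μ.prod ν) :=
    (hf.comp hmul).integrable_of_hasCompactSupport (HasCompactSupport.of_compactSpace _)
  rw [mulConv, integral_map hmul.aemeasurable hf.aestronglyMeasurable,
    integral_prod_symm _ hint]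

theorem moment_mulConv (μ ν : Measure unitInterval) [IsFiniteMeasure μ] [IsFiniteMeasure ν]
    (n : ℕ) : ∫ t, (t : ℝ) ^ n ∂(mulConv μ ν) = (∫ t, (t : ℝ) ^ n ∂μ) * ∫ t, (t : ℝ) ^ n ∂ν := by
  rw [integral_mulConv μ ν (f := fun t : unitInterval => (t : ℝ) ^ n) (by fun_prop)]
  simp only [Set.Icc.coe_mul, mul_pow, integral_mul_const, integral_const_mul]

/-- The derivative of the Hadamard product averages the dilates of the derivative of the first
factor. -/
theorem cauchyKernelSq_mulConv (μ ν : Measure unitInterval) [IsFiniteMeasure μ]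
    [IsFiniteMeasure ν] {z : ℂ} (hz : z ∈ slitDomain) :
    cauchyKernelSq (mulConv μ ν) z = ∫ s, cauchyKernelSq μ ((s : ℂ) * z) ∂ν := by
  rw [cauchyKernelSq, integral_mulConv μ ν (continuous_inv_one_sub_sq hz)]
  simp [cauchyKernelSq, mul_assoc]

theorem cauchyTransform_add_smul (μ ν : Measure unitInterval) [IsFiniteMeasure μ]
    [IsFiniteMeasure ν] (c : NNReal) {z : ℂ} (hz : z ∈ slitDomain) :
    cauchyTransform (μ + c • ν) z = cauchyTransform μ z + c * cauchyTransform ν z := by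
  have h1 := (continuous_inv_one_sub hz).integrable_unitInterval (μ := μ)
  have h2 := (continuous_inv_one_sub hz).integrable_unitInterval (μ := c • ν)
  rw [cauchyTransform, integral_add_measure h1 h2, integral_smul_nnreal_measure]
  simp [cauchyTransform, NNReal.smul_def]

/-! ### Taylor coefficients and Hadamard products -/

theorem taylorCoeff_eq_of_hasSum {f : ℂ → ℂ} {a : ℕ → ℂ}
    (h : ∀ z ∈ unitDisk, HasSum (fun n => a n * z ^ n) (f z)) (n : ℕ) : taylorCoeff f n = a n := by
  have hp : HasFPowerSeriesOnBall f (FormalMultilinearSeries.ofScalars ℂ a) 0 1 := by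
    refine ⟨ENNReal.le_of_forall_nnreal_lt fun r hr => ?_, zero_lt_one, fun {y} hy => ?_⟩
    · have hr1 : (r : ℝ) < 1 := by exact_mod_cast hr
      have h1 := (h (r : ℝ) (by simpa [unitDisk] using hr1)).summable.norm
      refine FormalMultilinearSeries.le_radius_of_summable_norm _ ?_
      simpa [FormalMultilinearSeries.ofScalars_norm] using h1
    · have hy1 : y ∈ unitDisk := by
        rw [← ENNReal.ofReal_one, Metric.eball_ofReal] at hy
        exact hy
      simpa [FormalMultilinearSeries.ofScalars_apply_eq, mul_comm] using h y hy1
  have h1 := hp.factorial_smul 1 n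
  rw [FormalMultilinearSeries.ofScalars_apply_eq] at h1
  rw [taylorCoeff, iteratedDeriv_eq_iteratedFDeriv, ← h1]
  have : (n.factorial : ℂ) ≠ 0 := by exact_mod_cast n.factorial_ne_zero
  simp only [one_pow, smul_eq_mul, mul_one, nsmul_eq_mul]
  field_simp

theorem hasSum_id_mul_cauchyTransform (μ : Measure unitInterval) [IsFiniteMeasure μ] {z : ℂ}
    (hz : z ∈ unitDisk) :
    HasSum (fun n : ℕ => (Nat.casesOn n 0 fun m => ((∫ t, (t : ℝ) ^ m ∂μ : ℝ) : ℂ) : ℂ) * z ^ n)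
      (z * cauchyTransform μ z) := by
  rw [← hasSum_nat_add_iff' 1]
  simpa [pow_succ, mul_comm, mul_left_comm, mul_assoc] using
    (hasSum_cauchyTransform μ hz).mul_left z

/-- The Hadamard product of `z F(z)` and `z G(z)` is `z` times the Hadamard product of `F` and `G`,
whose coefficients are the moments of the multiplicative convolution. -/
theorem hadamard_eq_of_eqOn {h g : ℂ → ℂ} (μ ν : Measure unitInterval) [IsFiniteMeasure μ]
    [IsFiniteMeasure ν] (hh : ∀ z ∈ unitDisk, h z = z * cauchyTransform μ z)
    (hg : ∀ z ∈ unitDisk, g z = z * cauchyTransform ν z) {z : ℂ} (hz : z ∈ unitDisk) :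
    hadamard h g z = z * cauchyTransform (mulConv μ ν) z := by
  rw [hadamard, ← (hasSum_id_mul_cauchyTransform (mulConv μ ν) hz).tsum_eq]
  refine tsum_congr fun n => ?_
  rw [taylorCoeff_eq_of_hasSum fun w hw => (hh w hw).symm ▸ hasSum_id_mul_cauchyTransform μ hw,
    taylorCoeff_eq_of_hasSum fun w hw => (hg w hw).symm ▸ hasSum_id_mul_cauchyTransform ν hw]
  cases n with
  | zero => simp
  | succ m => simp [moment_mulConv]

theorem exists_measure_of_mem_shiftedT {h : ℂ → ℂ} (hh : h ∈ shiftedT) :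
    ∃ μ : Measure unitInterval, IsProbabilityMeasure μ ∧
      ∀ z ∈ unitDisk, h z = z * cauchyTransform μ z := by
  obtain ⟨F, ⟨-, a, ⟨μ, hμ, ha⟩, ha0, hF⟩, hhF⟩ := hh
  refine ⟨μ, ⟨?_⟩, fun z hz => ?_⟩
  · have h1 := ha 0
    rw [ha0] at h1
    simp only [pow_zero, integral_const, smul_eq_mul, mul_one, measureReal_def] at h1
    exact (ENNReal.toReal_eq_one_iff _).1 h1.symm
  · rw [hhF z (unitDisk_subset_slitDomain hz)]
    congr 1
    refine (hF z hz).unique ?_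
    simpa only [ha] using hasSum_cauchyTransform μ hz

theorem cauchyTransform_mem_classT (μ : Measure unitInterval) [IsProbabilityMeasure μ] :
    cauchyTransform μ ∈ classT :=
  ⟨differentiableOn_cauchyTransform μ, fun n => ∫ t, (t : ℝ) ^ n ∂μ,
    ⟨μ, inferInstance, fun _ => rfl⟩, by simp, fun _ hz => hasSum_cauchyTransform μ hz⟩

theorem differentiableOn_of_mem_shiftedT {h : ℂ → ℂ} (hh : h ∈ shiftedT) :
    DifferentiableOn ℂ h slitDomain := by
  obtain ⟨F, ⟨hF, -⟩, hhF⟩ := hh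
  exact (differentiableOn_id.mul hF).congr hhF

instance (μ ν : Measure unitInterval) [IsProbabilityMeasure μ] [IsProbabilityMeasure ν] :
    IsProbabilityMeasure (mulConv μ ν) :=
  Measure.isProbabilityMeasure_map (by fun_prop)

/-! ### Harmonic mappings of the disk -/

theorem harmonicOnNhd_of_eq_add_conj {U : Set ℂ} (hU : IsOpen U) {A B f : ℂ → ℂ}
    (hA : DifferentiableOn ℂ A U) (hB : DifferentiableOn ℂ B U)
    (hf : ∀ z ∈ U, f z = A z + conj (B z)) : InnerProductSpace.HarmonicOnNhd f U := by
  intro z hz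
  have hUz := hU.mem_nhds hz
  have h := (hA.analyticAt hUz).harmonicAt.add (hB.analyticAt hUz).harmonicAt_conj
  refine (InnerProductSpace.harmonicAt_congr_nhds ?_).1 h
  filter_upwards [hUz] with w hw
  simp [hf w hw]

theorem wirtinger_of_eventuallyEq_add_conj {A B f : ℂ → ℂ} {z A' B' : ℂ}
    (hA : HasDerivAt A A' z) (hB : HasDerivAt B B' z)
    (hf : f =ᶠ[𝓝 z] fun w => A w + conj (B w)) : dz f z = A' ∧ dzbar f z = conj B' := by
  have hd := (hA.hasFDerivAt.restrictScalars ℝ).add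
    ((Complex.conjCLE.toContinuousLinearMap.hasFDerivAt (x := B z)).comp z
      (hB.hasFDerivAt.restrictScalars ℝ))
  have hfd := (hd.congr_of_eventuallyEq hf).fderiv
  constructor
  · rw [dz, hfd]
    simp
    linear_combination (-A' / 2 + conj B' / 2) * Complex.I_sq
  · rw [dzbar, hfd]
    simp
    linear_combination (A' / 2 - conj B' / 2) * Complex.I_sq

/-- A sheared Robertson function: if `A + B` satisfies Robertson's condition and
`|B'| ≤ k |A'|` with `k < 1`, then `A + conj B` is `k`-quasiconformal. It is injective by the shear
principle with `φ = A + B`, `ψ = A - B`, as `Re (ψ' / φ')` has the sign of `|A'|² - |B'|²`. -/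
theorem isQuasiconformalHarmonicOn_of_isRobertson {A B f : ℂ → ℂ} {k : ℝ} (hk : k < 1)
    (hA : DifferentiableOn ℂ A unitDisk) (hB : DifferentiableOn ℂ B unitDisk)
    (hAB : IsRobertson fun z => A z + B z) (hA0 : ∀ z ∈ unitDisk, deriv A z ≠ 0)
    (hle : ∀ z ∈ unitDisk, ‖deriv B z‖ ≤ k * ‖deriv A z‖)
    (hf : ∀ z ∈ unitDisk, f z = A z + conj (B z)) :
    IsQuasiconformalHarmonicOn k f unitDisk := by
  have hopen : IsOpen unitDisk := isOpen_ball
  have hlt : ∀ z ∈ unitDisk, ‖deriv B z‖ < ‖deriv A z‖ := fun z hz =>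
    (hle z hz).trans_lt (mul_lt_of_lt_one_left (norm_pos_iff.2 (hA0 z hz)) hk)
  have hdA : ∀ z ∈ unitDisk, HasDerivAt A (deriv A z) z := fun z hz =>
    ((hA z hz).differentiableAt (hopen.mem_nhds hz)).hasDerivAt
  have hdB : ∀ z ∈ unitDisk, HasDerivAt B (deriv B z) z := fun z hz =>
    ((hB z hz).differentiableAt (hopen.mem_nhds hz)).hasDerivAt
  have hW : ∀ z ∈ unitDisk, dz f z = deriv A z ∧ dzbar f z = conj (deriv B z) := fun z hz =>
    wirtinger_of_eventuallyEq_add_conj (hdA z hz) (hdB z hz)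
      (by filter_upwards [hopen.mem_nhds hz] with w hw using hf w hw)
  refine ⟨hk, ⟨harmonicOnNhd_of_eq_add_conj hopen hA hB hf, ?_, ?_⟩, ?_⟩
  · have hre : ∀ z ∈ unitDisk,
        0 < (deriv (fun z => A z - B z) z / deriv (fun z => A z + B z) z).re := by
      intro z hz
      have h0 := hAB.deriv_ne_zero hz
      have e1 : deriv (fun z => A z + B z) z = deriv A z + deriv B z :=
        ((hdA z hz).add (hdB z hz)).deriv
      have e2 : deriv (fun z => A z - B z) z = deriv A z - deriv B z :=
        ((hdA z hz).sub (hdB z hz)).deriv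
      rw [e1] at h0 ⊢
      rw [e2, Complex.div_re, ← add_div]
      refine div_pos ?_ (Complex.normSq_pos.2 h0)
      have h1 : Complex.normSq (deriv B z) < Complex.normSq (deriv A z) := by
        simp only [Complex.normSq_eq_norm_sq]
        gcongr
        exact hlt z hz
      simp only [Complex.normSq_apply] at h1
      simp only [Complex.add_re, Complex.add_im, Complex.sub_re, Complex.sub_im]
      linarith
    intro z hz w hw heq
    rw [hf z hz, hf w hw] at heq
    -- `f` has the real part of `A + B` and the imaginary part of `A - B`.
    have h_re := congrArg Complex.re heq
    have h_im := congrArg Complex.im heq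
    simp only [Complex.add_re, Complex.add_im, Complex.conj_re, Complex.conj_im] at h_re h_im
    exact eq_of_re_eq_of_im_eq_of_ordConnected hopen hAB.diff (hA.sub hB) hAB.injOn
      (fun z hz => hAB.deriv_ne_zero hz) hre hAB.ordConnected_slice hz hw
      (by simpa using h_re) (by simpa [sub_eq_add_neg] using h_im)
  · intro z hz
    rw [jacobian, (hW z hz).1, (hW z hz).2, Complex.norm_conj, sub_pos]
    gcongr
    exact hlt z hz
  · intro z hz
    rw [secondDilatation, (hW z hz).1, (hW z hz).2, Complex.conj_conj, norm_div,
      div_le_iff₀ (norm_pos_iff.2 (hA0 z hz))]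
    exact hle z hz

theorem norm_cauchyKernelSq_mulConv_le (μ ν : Measure unitInterval) [IsFiniteMeasure μ]
    [IsProbabilityMeasure ν] {z : ℂ} (hz : z ∈ slitDomain) {C : ℝ}
    (hC : ∀ s : unitInterval, ‖cauchyKernelSq μ ((s : ℂ) * z)‖ ≤ C) :
    ‖cauchyKernelSq (mulConv μ ν) z‖ ≤ C := by
  rw [cauchyKernelSq_mulConv μ ν hz]
  simpa using norm_integral_le_of_norm_le_const (μ := ν) (.of_forall hC)

end HarmonicHausdorff

end

open HarmonicHausdorff in
theorem theorem1p6 (h : ℂ → ℂ) (hh : h ∈ HarmonicHausdorff.shiftedT)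
    (c : ℝ) (hc0 : 0 ≤ c) (hc1 : c < 1) (M : ℝ)
    (hM : ∀ z ∈ HarmonicHausdorff.unitDisk, ∀ t : ℝ, 0 ≤ t → t ≤ 1 →
      ‖deriv h ((t : ℂ) * z) / deriv h z‖ ≤ M) :
    ∀ g ∈ HarmonicHausdorff.shiftedT, ∀ f : ℂ → ℂ,
      (∀ z ∈ HarmonicHausdorff.unitDisk,
        f z = h z + (c : ℂ) * conj (HarmonicHausdorff.hadamard h g z)) →
      (∃ F ∈ HarmonicHausdorff.classHT (c : ℂ), Set.EqOn F f HarmonicHausdorff.unitDisk) ∧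
      ∀ k : ℝ, c * M ≤ k → k < 1 →
        HarmonicHausdorff.IsQuasiconformalHarmonicOn k f HarmonicHausdorff.unitDisk := by
  intro g hg f hf
  obtain ⟨μ, hμ, hhμ⟩ := exists_measure_of_mem_shiftedT hh
  obtain ⟨ν, hν, hgν⟩ := exists_measure_of_mem_shiftedT hg
  set H : ℂ → ℂ := fun z => z * cauchyTransform (mulConv μ ν) z with hH
  have hHmem : H ∈ shiftedT := ⟨_, cauchyTransform_mem_classT (mulConv μ ν), fun _ _ => rfl⟩
  have hHdiff := differentiableOn_of_mem_shiftedT hHmem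
  have hhdiff := differentiableOn_of_mem_shiftedT hh
  have hfH : ∀ z ∈ unitDisk, f z = h z + (c : ℂ) * conj (H z) := fun z hz => by
    rw [hf z hz, hadamard_eq_of_eqOn μ ν hhμ hgν hz]
  refine ⟨⟨fun z => h z + (c : ℂ) * conj (H z), ⟨?_, h, hh, H, hHmem, fun _ _ => rfl⟩,
    fun z hz => (hfH z hz).symm⟩, fun k hk hk1 => ?_⟩
  · exact harmonicOnNhd_of_eq_add_conj isOpen_slitDomain hhdiff (hHdiff.const_mul (c : ℂ))
      fun z _ => by simp
  have hdh : ∀ z ∈ unitDisk, deriv h z = cauchyKernelSq μ z := by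
    intro z hz
    have : h =ᶠ[𝓝 z] fun z => z * cauchyTransform μ z := by
      filter_upwards [isOpen_ball.mem_nhds hz] with w hw using hhμ w hw
    rw [this.deriv_eq,
      (hasDerivAt_id_mul_cauchyTransform μ (unitDisk_subset_slitDomain hz)).deriv]
  have hh0 : ∀ z ∈ unitDisk, deriv h z ≠ 0 := by
    intro z hz
    have := (isRobertson_id_mul_cauchyTransform μ (IsProbabilityMeasure.ne_zero μ)).deriv_ne_zero hz
    rwa [(hasDerivAt_id_mul_cauchyTransform μ (unitDisk_subset_slitDomain hz)).deriv,
      ← hdh z hz] at this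
  refine isQuasiconformalHarmonicOn_of_isRobertson (A := h) (B := fun z => (c : ℂ) * H z) hk1
    (hhdiff.mono unitDisk_subset_slitDomain)
    ((hHdiff.mono unitDisk_subset_slitDomain).const_mul _) ?_ hh0 ?_ fun z hz => by
      simp [hfH z hz]
  -- `h + c H` is again a shifted Cauchy transform, of the measure `μ + c • mulConv μ ν`.
  · refine (isRobertson_id_mul_cauchyTransform (μ + c.toNNReal • mulConv μ ν) ?_).congr
      fun z hz => ?_
    · intro h0
      have := congrArg (fun m : Measure unitInterval => m univ) h0
      simp at this
    · beta_reduce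
      rw [cauchyTransform_add_smul μ _ _ (unitDisk_subset_slitDomain hz), hhμ z hz, hH]
      simp only [Real.coe_toNNReal c hc0]
      ring
  · intro z hz
    have hz' := unitDisk_subset_slitDomain hz
    have e : deriv (fun z => (c : ℂ) * H z) z = c * cauchyKernelSq (mulConv μ ν) z :=
      ((hasDerivAt_id_mul_cauchyTransform (mulConv μ ν) hz').const_mul (c : ℂ)).deriv
    have hbd : ‖cauchyKernelSq (mulConv μ ν) z‖ ≤ M * ‖deriv h z‖ := by
      refine norm_cauchyKernelSq_mulConv_le μ ν hz' fun s => ?_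
      have := hM z hz s s.2.1 s.2.2
      rwa [norm_div, div_le_iff₀ (norm_pos_iff.2 (hh0 z hz)), hdh _ (mul_mem_unitDisk hz s)] at this
    rw [e, norm_mul, Complex.norm_real, Real.norm_eq_abs, abs_of_nonneg hc0]
    calc c * ‖cauchyKernelSq (mulConv μ ν) z‖ ≤ c * (M * ‖deriv h z‖) := by gcongr
      _ = c * M * ‖deriv h z‖ := by ring
      _ ≤ k * ‖deriv h z‖ := by gcongr
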